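/- Let $s \ge 2$ and let $R = R_1 \times R_2 \times \cdots \times R_s$, where each $R_i$ is a finite commutative local ring with maximal ideal of order $m_i$, and where the factors are ordered so that $$|R_1|/m_1 \le |R_2|/m_2 \le \cdots \le |R_s|/m_s .$$ Let $G_R$ be the unitary Cayley graph of $R$, that is, the graph with vertex set $R$ in which $x$ and $y$ are adjacent if and only if $x-y$ is a unit of $R$, and let $\overline{G}_R$ be its complement. A finite $r$-regular graph is called Ramanujan if every eigenvalue of its adjacency matrix other than $\pm r$ has absolute value at most $2\sqrt{r-1}$. Write $R^\times$ for the group of units of $R$. Then $\overline{G}_R$ is Ramanujan if and only if one of the following conditions holds: (a) $|R_i|/m_i = 2$ for all $1 \le i \le s$, and $$\prod_{i=1}^s m_i \le 2^{s+1} - 3 + 2\sqrt{2^s(2^s-3)};$$ (b) $2 = |R_1|/m_1 = \cdots = |R_t|/m_t < |R_{t+1}|/m_{t+1}$ for some $t$ with $2 \le t < s$, and $$|R^\times| \le 2\sqrt{|R|} - 3;$$ (c) $2 = |R_1|/m_1 < |R_2|/m_2$, and $$|R^\times| \le 2\sqrt{|R|-2} - 1;$$ (d) $3 \le |R_1|/m_1$,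 and $$\frac{|R^\times|}{(|R_1|/m_1)-1} \le -\left(2\frac{|R_1|}{m_1}-3\right) + \sqrt{\left(2\frac{|R_1|}{m_1}-3\right)^2 + (4|R|-9)} .$$ -/

import Mathlib

open scoped Classical in
/-- A finite graph is Ramanujan if it is `r`-regular for some `r` and every eigenvalue of its
adjacency matrix other than `r` and `-r` has absolute value at most `2 √(r - 1)`. -/
def IsRamanujan {V : Type*} [Fintype V] (G : SimpleGraph V) : Prop :=
  ∃ r : ℕ, G.IsRegularOfDegree r ∧
    ∀ μ : ℝ, Module.End.HasEigenvalue (Matrix.toLin' (G.adjMatrix ℝ)) μ →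
      μ ≠ (r : ℝ) → μ ≠ -(r : ℝ) → |μ| ≤ 2 * √((r : ℝ) - 1)

/-- The unitary Cayley graph of a ring: the Cayley graph of the additive group with respect to
the set of units. -/
def unitaryCayleyGraph (A : Type*) [Ring A] : SimpleGraph A :=
  SimpleGraph.addCayley {x : A | IsUnit x}

theorem unitaryCayleyGraph_adj {A : Type*} [Ring A] [Nontrivial A] (x y : A) :
    (unitaryCayleyGraph A).Adj x y ↔ IsUnit (x - y) := by
  unfold unitaryCayleyGraph
  rw [SimpleGraph.addCayley_adj']
  constructor
  · rintro ⟨-, g, hg, h | h⟩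
    · rw [← h]
      simpa using IsUnit.neg hg
    · rw [h]
      simpa using hg
  · intro h
    refine ⟨?_, x - y, h, Or.inr (by abel)⟩
    rintro rfl
    simp at h

/-- The order of the maximal ideal of a local ring. -/
noncomputable def maxIdealCard (A : Type*) [CommRing A] [IsLocalRing A] : ℕ :=
  Nat.card (IsLocalRing.maximalIdeal A)

/-- The ratio `|A| / m`, where `m` is the order of the maximal ideal of the local ring `A`. -/
noncomputable def residueRatio (A : Type*) [CommRing A] [IsLocalRing A] : ℝ :=
  (Nat.card A : ℝ) / (maxIdealCard A : ℝ)

/-!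
The graph is a Cayley graph of the additive group of a finite ring, so its adjacency eigenvalues are
the sums of additive characters over the connection set
(`hasEigenvalue_adjMatrix_iff_exists_addChar`). For the complement of a unitary Cayley graph, the
trivial character gives the degree `r = |R| - 1 - |Rˣ|`, and a nontrivial character `ψ` gives
`-1 - ∑ ψ(u)`, the sum being over the units `u`.

Over a local ring with maximal ideal of order `m` and residue field of order `q`, the sum of a
nontrivial character over the units is `-m` or `0`, as the units are the complement of the maximal
ideal (`unitSum_of_ne_zero`); for the trivial character it is `m (q - 1)`. Over a product of local
rings these sums multiply, so the sum over all units is `|Rˣ|` times a product of factors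
`-1 / (q_i - 1)` or `0`, one for each coordinate at which `ψ` is nontrivial
(`exists_unitSum_pi_eq`), and any nonempty set of coordinates is realised by a character with
factors `-1 / (q_i - 1)` (`exists_unitSum_pi_eq_prod_inv`).

If two residue fields have order two, the character supported there gives the eigenvalue
`-1 - |Rˣ|`, the largest possible absolute value among nontrivial characters
(`isRamanujan_compl_pi_iff_of_two_eq_two`). Otherwise, with `q₀` the least residue order, the
decisive eigenvalue is `a - 1` for `a = |Rˣ| / (q₀ - 1)`: every other one either lies in
`[-1, a - 1]` or has absolute value at most `1 + a / 2`
(`isRamanujan_compl_pi_iff_of_three_le`). In both cases comparing the square of the decisive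
eigenvalue with `4 (r - 1)` is a quadratic inequality, whose solutions are the bounds claimed.
-/

/-! ### Eigenvalues of graphs defined by differences in a finite abelian group -/

open scoped Classical in
/-- The spectrum of a Cayley graph of a finite abelian group: the eigenvalues are the sums of the
additive characters over the connection set. -/
theorem hasEigenvalue_adjMatrix_iff_exists_addChar {A : Type*} [AddCommGroup A] [Fintype A]
    (G : SimpleGraph A) (D : Set A) (hG : ∀ x y, G.Adj x y ↔ x - y ∈ D) (μ : ℝ) :
    Module.End.HasEigenvalue (Matrix.toLin' (G.adjMatrix ℝ)) μ ↔
      ∃ ψ : AddChar A ℂ, ∑ d with d ∈ D, ψ d = μ := by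
  have key : ∀ (f : A → ℝ) (x : A),
      Matrix.toLin' (G.adjMatrix ℝ) f x = ∑ d with d ∈ D, f (x - d) := by
    intro f x
    rw [Matrix.toLin'_apply, SimpleGraph.adjMatrix_mulVec_apply, SimpleGraph.neighborFinset_eq_filter]
    simp only [hG]
    refine Finset.sum_bij' (fun y _ => x - y) (fun d _ => x - d) ?_ ?_ ?_ ?_ ?_ <;> simp
  constructor
  · intro h
    obtain ⟨f, hf⟩ := h.exists_hasEigenvector
    have hfμ : ∀ x, ∑ d with d ∈ D, f (x - d) = μ * f x := by
      intro x
      rw [← key, hf.apply_eq_smul]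
      rfl
    -- The characters span all functions, so some Fourier coefficient of `f` is nonzero.
    obtain ⟨ψ, hψ⟩ : ∃ ψ : AddChar A ℂ, ∑ x, (f x : ℂ) * ψ x ≠ 0 := by
      by_contra! hc
      have hL : (∑ x, (f x : ℂ) • LinearMap.proj (R := ℂ) (φ := fun _ : A => ℂ) x) = 0 := by
        refine (AddChar.complexBasis A).ext fun ψ => ?_
        simpa using hc ψ
      apply hf.2
      ext x
      have := congrArg (fun L => L (Pi.single x (1 : ℂ))) hL
      simpa [Pi.single_apply] using this
    refine ⟨ψ, ?_⟩
    have h1 : ∑ x, ((∑ d with d ∈ D, f (x - d) : ℝ) : ℂ) * ψ x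
        = (∑ d with d ∈ D, ψ d) * ∑ x, (f x : ℂ) * ψ x := by
      push_cast
      simp only [Finset.sum_mul]
      rw [Finset.sum_comm]
      refine Finset.sum_congr rfl fun d _ => ?_
      rw [Finset.mul_sum, ← Equiv.sum_comp (Equiv.addRight d)]
      refine Finset.sum_congr rfl fun x _ => ?_
      simp only [Equiv.coe_addRight, add_sub_cancel_right, AddChar.map_add_eq_mul]
      ring
    have h2 : ∑ x, ((∑ d with d ∈ D, f (x - d) : ℝ) : ℂ) * ψ x = μ * ∑ x, (f x : ℂ) * ψ x := by
      simp only [hfμ, Finset.mul_sum]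
      refine Finset.sum_congr rfl fun x _ => ?_
      push_cast
      ring
    exact mul_right_cancel₀ hψ (h1.symm.trans h2)
  · rintro ⟨ψ, hψ⟩
    -- The matrix and the eigenvalue are real, so the real part of a character is an eigenvector.
    refine Module.End.hasEigenvalue_of_hasEigenvector (x := fun x => (ψ (-x)).re) ⟨?_, ?_⟩
    · rw [Module.End.mem_eigenspace_iff]
      ext x
      rw [key]
      have : ∀ d, ψ (-(x - d)) = ψ d * ψ (-x) := fun d => by
        rw [← AddChar.map_add_eq_mul]; congr 1; abel
      simp only [this, ← Complex.re_sum, ← Finset.sum_mul, hψ]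
      simp
    · intro h
      simpa using congrFun h 0

/-! ### Character sums over units -/

open scoped Classical in
/-- The sum of an additive character over the units of a finite ring. -/
noncomputable def unitSum {A : Type*} [CommRing A] [Fintype A] (ψ : AddChar A ℂ) : ℂ :=
  ∑ x with IsUnit x, ψ x

theorem unitSum_zero {A : Type*} [CommRing A] [Fintype A] :
    unitSum (0 : AddChar A ℂ) = Nat.card Aˣ := by
  classical
  rw [unitSum]
  simp only [AddChar.zero_apply, Finset.sum_const, nsmul_eq_mul, mul_one]
  rw [← Fintype.card_subtype, ← Nat.card_eq_fintype_card]
  congr 1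
  refine Nat.card_congr (Equiv.symm (Equiv.ofBijective (fun u : Aˣ => ⟨u, u.isUnit⟩) ⟨?_, ?_⟩))
  · exact fun u v h => Units.ext (congrArg Subtype.val h)
  · rintro ⟨_, u, rfl⟩
    exact ⟨u, rfl⟩

theorem unitSum_sum_compAddMonoidHom {ι : Type*} [Fintype ι] {R : ι → Type*}
    [∀ i, CommRing (R i)] [∀ i, Fintype (R i)] [Fintype (∀ i, R i)] (φ : ∀ i, AddChar (R i) ℂ) :
    unitSum (∑ i, (φ i).compAddMonoidHom (Pi.evalAddMonoidHom R i)) = ∏ i, unitSum (φ i) := by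
  classical
  simp only [unitSum, Finset.prod_univ_sum]
  refine Finset.sum_congr ?_ fun x _ => ?_
  · ext x
    simp [Pi.isUnit_iff]
  · simp [AddChar.sum_apply]

theorem AddChar.eq_sum_compAddMonoidHom {ι : Type*} [Fintype ι] [DecidableEq ι] {R : ι → Type*}
    [∀ i, AddCommGroup (R i)] (ψ : AddChar (∀ i, R i) ℂ) :
    ψ = ∑ i, (ψ.compAddMonoidHom (AddMonoidHom.single R i)).compAddMonoidHom
      (Pi.evalAddMonoidHom R i) := by
  ext x
  conv_lhs => rw [← Finset.univ_sum_single x]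
  have := map_sum ψ.toAddMonoidHom (fun i => Pi.single i (x i)) Finset.univ
  simp only [AddChar.toAddMonoidHom_apply, ← ofMul_prod] at this
  rw [Additive.ofMul.injective this]
  simp [AddChar.sum_apply]

theorem sum_compAddMonoidHom_eq_zero_iff {ι : Type*} [Fintype ι] {R : ι → Type*}
    [∀ i, AddCommGroup (R i)] (φ : ∀ i, AddChar (R i) ℂ) :
    ∑ i, (φ i).compAddMonoidHom (Pi.evalAddMonoidHom R i) = 0 ↔ ∀ i, φ i = 0 := by
  classical
  constructor
  · intro h i
    ext x
    have := congrArg (fun ψ => ψ (Pi.single i x)) h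
    simp only [AddChar.sum_apply, AddChar.compAddMonoidHom_apply, Pi.evalAddMonoidHom_apply] at this
    rw [Finset.prod_eq_single i] at this
    · simpa using this
    · intro j _ hj
      simp [hj]
    · simp
  · intro h
    ext x
    simp [AddChar.sum_apply, h]

section LocalRing

variable {A : Type*} [CommRing A] [IsLocalRing A]

theorem card_eq_maxIdealCard_mul_card_residueField :
    Nat.card A = maxIdealCard A * Nat.card (IsLocalRing.ResidueField A) :=
  ((IsLocalRing.maximalIdeal A).toAddSubgroup.card_mul_index).symm

variable [Fintype A]

theorem maxIdealCard_pos : 0 < maxIdealCard A := Nat.card_pos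

theorem residueRatio_eq_card_residueField :
    residueRatio A = Nat.card (IsLocalRing.ResidueField A) := by
  have : (maxIdealCard A : ℝ) ≠ 0 := by exact_mod_cast (maxIdealCard_pos (A := A)).ne'
  rw [residueRatio, card_eq_maxIdealCard_mul_card_residueField]
  push_cast
  field_simp

open scoped Classical in
theorem unitSum_eq_sub (ψ : AddChar A ℂ) :
    unitSum ψ = ∑ x, ψ x -
      ∑ x : IsLocalRing.maximalIdeal A,
        ψ.compAddMonoidHom (IsLocalRing.maximalIdeal A).subtype.toAddMonoidHom x := by
  classical
  rw [unitSum, ← Finset.sum_filter_add_sum_filter_not Finset.univ (fun x : A => IsUnit x),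
    eq_sub_iff_add_eq]
  congr 1
  refine Finset.sum_bij (fun x _ => x.1) ?_ ?_ ?_ ?_
  · intro x _
    exact Finset.mem_filter.2 ⟨Finset.mem_univ _, (IsLocalRing.mem_maximalIdeal _).1 x.2⟩
  · exact fun x _ y _ h => Subtype.ext h
  · intro x hx
    exact ⟨⟨x, by simpa using hx⟩, Finset.mem_univ _, rfl⟩
  · intro x _
    rfl

theorem unitSum_of_ne_zero {ψ : AddChar A ℂ} (hψ : ψ ≠ 0) :
    unitSum ψ = -maxIdealCard A ∨ unitSum ψ = 0 := by
  classical
  rw [unitSum_eq_sub, AddChar.sum_eq_zero_iff_ne_zero.2 hψ, AddChar.sum_eq_ite]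
  split_ifs
  · left
    simp [maxIdealCard]
  · simp

theorem card_units_add_maxIdealCard : Nat.card Aˣ + maxIdealCard A = Nat.card A := by
  classical
  have h := unitSum_eq_sub (0 : AddChar A ℂ)
  rw [unitSum_zero] at h
  simp at h
  rw [eq_sub_iff_add_eq] at h
  have : ((Nat.card Aˣ + maxIdealCard A : ℕ) : ℂ) = (Nat.card A : ℕ) := by
    simpa [maxIdealCard] using h
  exact_mod_cast this

theorem exists_unitSum_eq_neg_maxIdealCard :
    ∃ ψ : AddChar A ℂ, ψ ≠ 0 ∧ unitSum ψ = -maxIdealCard A := by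
  classical
  have : Finite (IsLocalRing.ResidueField A) :=
    Finite.of_surjective _ IsLocalRing.residue_surjective
  obtain ⟨χ, hχ⟩ := AddChar.exists_apply_ne_zero.2
    (one_ne_zero : (1 : IsLocalRing.ResidueField A) ≠ 0)
  let ψ : AddChar A ℂ := χ.compAddMonoidHom (IsLocalRing.residue A).toAddMonoidHom
  have hψ : ψ ≠ 0 := by
    intro h
    apply hχ
    simpa [ψ] using congrArg (fun ψ => ψ 1) h
  refine ⟨ψ, hψ, ?_⟩
  rw [unitSum_eq_sub, AddChar.sum_eq_zero_iff_ne_zero.2 hψ, AddChar.sum_eq_ite, if_pos]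
  · simp [maxIdealCard]
  · ext x
    simp [ψ, (IsLocalRing.residue_eq_zero_iff x.1).2 x.2]

end LocalRing

/-! ### The complement of a unitary Cayley graph -/

section Compl

variable {A : Type*} [CommRing A] [Nontrivial A]

theorem compl_unitaryCayleyGraph_adj (x y : A) :
    (unitaryCayleyGraph A)ᶜ.Adj x y ↔ x - y ∈ {d : A | d ≠ 0 ∧ ¬ IsUnit d} := by
  rw [SimpleGraph.compl_adj, unitaryCayleyGraph_adj, Set.mem_ofPred_eq, sub_ne_zero]

variable [Fintype A]

open scoped Classical in
theorem sum_addChar_ne_zero_not_isUnit (ψ : AddChar A ℂ) :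
    ∑ d with d ∈ {d : A | d ≠ 0 ∧ ¬ IsUnit d}, ψ d = ∑ d, ψ d - 1 - unitSum ψ := by
  have h1 : ({d | d ∈ {d : A | d ≠ 0 ∧ ¬ IsUnit d}} : Finset A)
      = ({d : A | ¬ IsUnit d} : Finset A).erase 0 := by
    ext d
    simp
  rw [h1, Finset.sum_erase_eq_sub (by simp), unitSum,
    ← Finset.sum_filter_add_sum_filter_not Finset.univ (fun x : A => IsUnit x)]
  simp only [AddChar.map_zero_eq_one]
  ring

open scoped Classical in
theorem compl_unitaryCayleyGraph_degree (x : A) :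
    ((unitaryCayleyGraph A)ᶜ.degree x : ℝ) = Nat.card A - 1 - Nat.card Aˣ := by
  have h := sum_addChar_ne_zero_not_isUnit (0 : AddChar A ℂ)
  rw [unitSum_zero] at h
  have h2 : (unitaryCayleyGraph A)ᶜ.degree x
      = ({d | d ∈ {d : A | d ≠ 0 ∧ ¬ IsUnit d}} : Finset A).card := by
    rw [← SimpleGraph.card_neighborFinset_eq_degree]
    refine Finset.card_bij' (fun y _ => x - y) (fun d _ => x - d) ?_ ?_ ?_ ?_
    · intro y hy
      rw [SimpleGraph.mem_neighborFinset, compl_unitaryCayleyGraph_adj] at hy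
      simpa using hy
    · intro d hd
      rw [SimpleGraph.mem_neighborFinset, compl_unitaryCayleyGraph_adj]
      simpa using hd
    · simp
    · simp
  rw [h2]
  have h3 : ((({d | d ∈ {d : A | d ≠ 0 ∧ ¬ IsUnit d}} : Finset A).card : ℝ) : ℂ)
      = ((Nat.card A - 1 - Nat.card Aˣ : ℝ) : ℂ) := by
    push_cast
    simpa using h
  exact_mod_cast h3

/-- The trivial character gives the degree itself, so only the nonzero characters matter. -/
theorem isRamanujan_compl_iff :
    IsRamanujan (unitaryCayleyGraph A)ᶜ ↔
      ∀ ψ : AddChar A ℂ, ψ ≠ 0 → ∀ μ : ℝ, (μ : ℂ) = -1 - unitSum ψ →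
        μ ≠ Nat.card A - 1 - Nat.card Aˣ → μ ≠ -(Nat.card A - 1 - Nat.card Aˣ) →
          |μ| ≤ 2 * √((Nat.card A - 1 - Nat.card Aˣ : ℝ) - 1) := by
  classical
  have hspec := hasEigenvalue_adjMatrix_iff_exists_addChar (unitaryCayleyGraph A)ᶜ _
    compl_unitaryCayleyGraph_adj
  have hspec : ∀ μ : ℝ, Module.End.HasEigenvalue
      (Matrix.toLin' ((unitaryCayleyGraph A)ᶜ.adjMatrix ℝ)) μ ↔
        ∃ ψ : AddChar A ℂ, ∑ d, ψ d - 1 - unitSum ψ = μ := by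
    intro μ
    simp only [← sum_addChar_ne_zero_not_isUnit]
    convert hspec μ
  constructor
  · rintro ⟨r, hr, h⟩ ψ hψ μ hμ
    have hdeg : (r : ℝ) = Nat.card A - 1 - Nat.card Aˣ := by
      rw [← compl_unitaryCayleyGraph_degree (0 : A), ← hr 0]
      congr!
    rw [← hdeg]
    refine h μ ?_
    convert (hspec μ).2 ⟨ψ, ?_⟩
    rw [AddChar.sum_eq_zero_iff_ne_zero.2 hψ, hμ]
    ring
  · intro h
    refine ⟨(unitaryCayleyGraph A)ᶜ.degree 0, ?_, ?_⟩
    · intro x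
      have := (compl_unitaryCayleyGraph_degree x).trans (compl_unitaryCayleyGraph_degree 0).symm
      rw [← Nat.cast_inj (R := ℝ), ← this]
      congr!
    · intro μ hμ
      rw [compl_unitaryCayleyGraph_degree]
      intro h1 h2
      obtain ⟨ψ, hψ⟩ := (hspec μ).1 (by convert hμ)
      by_cases h0 : ψ = 0
      · exfalso
        apply h1
        rw [h0, unitSum_zero] at hψ
        simp only [AddChar.zero_apply, Finset.sum_const, Finset.card_univ, nsmul_eq_mul,
          mul_one, ← Nat.card_eq_fintype_card] at hψ
        exact_mod_cast hψ.symm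
      · refine h ψ h0 μ ?_ h1 h2
        rw [← hψ, AddChar.sum_eq_zero_iff_ne_zero.2 h0]
        ring

end Compl

/-! ### Character sums over the units of a product of local rings -/

section Product

variable {ι : Type*} [Fintype ι] {R : ι → Type*} [∀ i, CommRing (R i)] [∀ i, IsLocalRing (R i)]
  [∀ i, Fintype (R i)]

theorem card_units_eq_maxIdealCard_mul (A : Type*) [CommRing A] [IsLocalRing A] [Fintype A] :
    (Nat.card Aˣ : ℝ) = maxIdealCard A * (residueRatio A - 1) := by
  have h : ((Nat.card Aˣ + maxIdealCard A : ℕ) : ℝ) = (Nat.card A : ℕ) :=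
    congrArg _ card_units_add_maxIdealCard
  rw [card_eq_maxIdealCard_mul_card_residueField (A := A)] at h
  rw [residueRatio_eq_card_residueField]
  push_cast at h
  linarith

theorem card_eq_maxIdealCard_mul_residueRatio (A : Type*) [CommRing A] [IsLocalRing A]
    [Fintype A] : (Nat.card A : ℝ) = maxIdealCard A * residueRatio A := by
  rw [card_eq_maxIdealCard_mul_card_residueField, residueRatio_eq_card_residueField]
  push_cast
  rfl

theorem card_pi_units : (Nat.card (∀ i, R i)ˣ : ℝ)
    = ∏ i, ((maxIdealCard (R i) : ℝ) * (residueRatio (R i) - 1)) := by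
  rw [Nat.card_congr MulEquiv.piUnits.toEquiv, Nat.card_pi]
  push_cast
  exact Finset.prod_congr rfl fun i _ => card_units_eq_maxIdealCard_mul (R i)

theorem card_pi_eq_prod : (Nat.card (∀ i, R i) : ℝ)
    = ∏ i, ((maxIdealCard (R i) : ℝ) * residueRatio (R i)) := by
  rw [Nat.card_pi]
  push_cast
  exact Finset.prod_congr rfl fun i _ => card_eq_maxIdealCard_mul_residueRatio (R i)

theorem residueRatio_eq_two_or_three_le (A : Type*) [CommRing A] [IsLocalRing A] [Fintype A] :
    residueRatio A = 2 ∨ 3 ≤ residueRatio A := by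
  have : Finite (IsLocalRing.ResidueField A) :=
    Finite.of_surjective _ IsLocalRing.residue_surjective
  have h : 1 < Nat.card (IsLocalRing.ResidueField A) := Finite.one_lt_card
  rw [residueRatio_eq_card_residueField]
  rcases (show Nat.card (IsLocalRing.ResidueField A) = 2 ∨
    3 ≤ Nat.card (IsLocalRing.ResidueField A) by omega) with h | h
  · left
    exact_mod_cast h
  · right
    exact_mod_cast h

/-- A character sum over the units of a product of local rings, relative to the number of units:
each coordinate where the character is nontrivial contributes `-1 / (q - 1)` or `0`. -/
theorem exists_unitSum_pi_eq [Fintype (∀ i, R i)] {ψ : AddChar (∀ i, R i) ℂ} (hψ : ψ ≠ 0) :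
    ∃ e : ι → ℝ, (∀ i, e i = 1 ∨ e i = -(residueRatio (R i) - 1)⁻¹ ∨ e i = 0) ∧
      (∃ i, e i = -(residueRatio (R i) - 1)⁻¹ ∨ e i = 0) ∧
      unitSum ψ = ((Nat.card (∀ i, R i)ˣ * ∏ i, e i : ℝ) : ℂ) := by
  classical
  set φ := fun i => ψ.compAddMonoidHom (AddMonoidHom.single R i)
  have hφ : ψ = ∑ i, (φ i).compAddMonoidHom (Pi.evalAddMonoidHom R i) :=
    AddChar.eq_sum_compAddMonoidHom ψ
  have hloc : ∀ i, ∃ x : ℝ, (x = 1 ∨ x = -(residueRatio (R i) - 1)⁻¹ ∨ x = 0) ∧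
      (φ i ≠ 0 → x = -(residueRatio (R i) - 1)⁻¹ ∨ x = 0) ∧
      unitSum (φ i) = ((maxIdealCard (R i) * (residueRatio (R i) - 1) * x : ℝ) : ℂ) := by
    intro i
    have hq : residueRatio (R i) - 1 ≠ 0 := by
      rcases residueRatio_eq_two_or_three_le (R i) with h | h <;> linarith
    by_cases h : φ i = 0
    · refine ⟨1, by simp, by simp [h], ?_⟩
      rw [h, unitSum_zero, mul_one, ← card_units_eq_maxIdealCard_mul]
      simp
    · rcases unitSum_of_ne_zero h with h' | h'
      · refine ⟨-(residueRatio (R i) - 1)⁻¹, by simp, by simp, ?_⟩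
        rw [h', mul_neg, mul_assoc, mul_inv_cancel₀ hq]
        simp
      · exact ⟨0, by simp, by simp, by simp [h']⟩
  choose e he1 he2 he3 using hloc
  refine ⟨e, he1, ?_, ?_⟩
  · by_contra! hc
    apply hψ
    rw [hφ, sum_compAddMonoidHom_eq_zero_iff]
    intro i
    by_contra h
    rcases he2 i h with h' | h'
    · exact (hc i).1 h'
    · exact (hc i).2 h'
  · rw [hφ, unitSum_sum_compAddMonoidHom, card_pi_units, ← Finset.prod_mul_distrib]
    push_cast
    exact Finset.prod_congr rfl fun i _ => by simpa using he3 i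

theorem exists_unitSum_pi_eq_prod_inv [Fintype (∀ i, R i)] (C : Finset ι) (hC : C.Nonempty) :
    ∃ ψ : AddChar (∀ i, R i) ℂ, ψ ≠ 0 ∧
      unitSum ψ = ((Nat.card (∀ i, R i)ˣ *
        ∏ i ∈ C, -(residueRatio (R i) - 1)⁻¹ : ℝ) : ℂ) := by
  classical
  choose χ hχ0 hχ using fun i => exists_unitSum_eq_neg_maxIdealCard (A := R i)
  let φ : ∀ i, AddChar (R i) ℂ := fun i => if i ∈ C then χ i else 0
  refine ⟨∑ i, (φ i).compAddMonoidHom (Pi.evalAddMonoidHom R i), ?_, ?_⟩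
  · rw [Ne, sum_compAddMonoidHom_eq_zero_iff]
    intro h
    obtain ⟨i, hi⟩ := hC
    exact hχ0 i (by simpa [φ, hi] using h i)
  · rw [unitSum_sum_compAddMonoidHom, card_pi_units, ← Finset.prod_ite_mem_eq C,
      ← Finset.prod_mul_distrib]
    push_cast
    refine Finset.prod_congr rfl fun i _ => ?_
    have hq : residueRatio (R i) - 1 ≠ 0 := by
      rcases residueRatio_eq_two_or_three_le (R i) with h | h <;> linarith
    by_cases hi : i ∈ C
    · have : ((residueRatio (R i) : ℂ) - 1) ≠ 0 := by exact_mod_cast hq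
      simp only [φ, hi, if_true, hχ]
      push_cast
      field_simp
    · simp only [φ, hi, if_false, unitSum_zero]
      have := card_units_eq_maxIdealCard_mul (R i)
      rw [← Complex.ofReal_natCast, this]
      simp

end Product

/-! ### Inequalities between products -/

section Inequalities

theorem Finset.prod_add_one_le_prod {ι : Type*} {S : Finset ι} (hS : S.Nonempty) {f g : ι → ℝ}
    (hf : ∀ i ∈ S, 0 ≤ f i) (hfg : ∀ i ∈ S, f i + 1 ≤ g i) :
    ∏ i ∈ S, f i + 1 ≤ ∏ i ∈ S, g i := by
  induction hS using Finset.Nonempty.cons_induction with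
  | singleton i => simpa using hfg
  | cons i S hi hS ih =>
    rw [Finset.prod_cons, Finset.prod_cons]
    have h1 := ih (fun j hj => hf j (Finset.mem_cons_of_mem hj))
      fun j hj => hfg j (Finset.mem_cons_of_mem hj)
    have h2 := hfg i (Finset.mem_cons_self i S)
    have h3 := hf i (Finset.mem_cons_self i S)
    have h4 : 0 ≤ ∏ j ∈ S, f j :=
      Finset.prod_nonneg fun j hj => hf j (Finset.mem_cons_of_mem hj)
    nlinarith [mul_le_mul h2 h1 (by positivity) (by linarith)]

variable {ι : Type*} {q e : ι → ℝ}

theorem abs_le_one_of_eq_neg_inv (hq : ∀ i, 2 ≤ q i)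
    (he : ∀ i, e i = 1 ∨ e i = -(q i - 1)⁻¹ ∨ e i = 0) (i : ι) : |e i| ≤ 1 := by
  rcases he i with h | h | h <;> rw [h]
  · simp
  · have := hq i
    rw [abs_neg, abs_of_nonneg (by rw [inv_nonneg]; linarith)]
    exact inv_le_one_of_one_le₀ (by linarith)
  · simp

theorem Finset.abs_prod_le_one {S : Finset ι} (he : ∀ i, |e i| ≤ 1) : |∏ i ∈ S, e i| ≤ 1 := by
  rw [Finset.abs_prod]
  exact Finset.prod_le_one (fun i _ => abs_nonneg _) fun i _ => he i

variable [Fintype ι]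

/-- If all factors but the smallest have `q ≥ 3`, then a normalised nonprincipal eigenvalue of the
unitary Cayley graph is either nonpositive and at least `-1 / (q₀ - 1)`, or has at most half that
absolute value, since it involves at least two of the factors `1 / (q - 1)`. -/
theorem prod_mem_Icc_or_abs_prod_le {i₀ : ι} (hq2 : 2 ≤ q i₀) (hmin : ∀ i, q i₀ ≤ q i)
    (hq3 : ∀ i, i ≠ i₀ → 3 ≤ q i) (he : ∀ i, e i = 1 ∨ e i = -(q i - 1)⁻¹ ∨ e i = 0)
    (hex : ∃ i, e i = -(q i - 1)⁻¹ ∨ e i = 0) :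
    (-(q i₀ - 1)⁻¹ ≤ ∏ i, e i ∧ ∏ i, e i ≤ 0) ∨ |∏ i, e i| ≤ (q i₀ - 1)⁻¹ / 2 := by
  classical
  have hq : ∀ i, 2 ≤ q i := fun i => hq2.trans (hmin i)
  have hpos : 0 < (q i₀ - 1)⁻¹ := by rw [inv_pos]; linarith
  have hle : ∀ i, (q i - 1)⁻¹ ≤ (q i₀ - 1)⁻¹ := fun i =>
    inv_anti₀ (by linarith) (by linarith [hmin i])
  have hnn : ∀ i, 0 ≤ (q i - 1)⁻¹ := fun i => by
    rw [inv_nonneg]; linarith [hq i]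
  by_cases h0 : ∃ i, e i = 0
  · obtain ⟨i, hi⟩ := h0
    rw [Finset.prod_eq_zero (Finset.mem_univ i) hi]
    left
    constructor <;> linarith
  push Not at h0
  obtain ⟨k, hk⟩ := hex
  replace hk := hk.resolve_right (h0 k)
  rw [← Finset.mul_prod_erase _ _ (Finset.mem_univ k)]
  by_cases hl : ∃ l, l ≠ k ∧ e l ≠ 1
  · obtain ⟨l, hlk, hl⟩ := hl
    have hel : e l = -(q l - 1)⁻¹ := ((he l).resolve_left hl).resolve_right (h0 l)
    right
    rw [← Finset.mul_prod_erase _ _ (Finset.mem_erase.2 ⟨hlk, Finset.mem_univ l⟩), ← mul_assoc,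
      abs_mul]
    have h1 := Finset.abs_prod_le_one (S := (Finset.univ.erase k).erase l)
      (abs_le_one_of_eq_neg_inv hq he)
    have hhalf : ∀ i, i ≠ i₀ → (q i - 1)⁻¹ ≤ 1 / 2 := fun i hi => by
      rw [one_div]
      exact inv_anti₀ (by norm_num) (by linarith [hq3 i hi])
    have h2 : |e k * e l| ≤ (q i₀ - 1)⁻¹ / 2 := by
      rw [hk, hel, neg_mul_neg, abs_of_nonneg (mul_nonneg (hnn k) (hnn l))]
      by_cases hk0 : k = i₀
      · have := hhalf l (by rw [← hk0]; exact hlk)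
        nlinarith [mul_le_mul (hle k) this (hnn l) hpos.le]
      · nlinarith [mul_le_mul (hhalf k hk0) (hle l) (hnn l) (by norm_num)]
    calc _ ≤ (q i₀ - 1)⁻¹ / 2 * 1 := mul_le_mul h2 h1 (abs_nonneg _) (by linarith)
      _ = _ := mul_one _
  · push Not at hl
    left
    rw [Finset.prod_eq_one fun l h => hl l (Finset.ne_of_mem_erase h), mul_one, hk]
    exact ⟨neg_le_neg (hle k), neg_nonpos.2 (hnn k)⟩

theorem four_mul_prod_le_prod {m : ι → ℝ} (hm : ∀ i, 1 ≤ m i) (hq : ∀ i, 2 ≤ q i) {i₀ i₁ : ι}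
    (hne : i₁ ≠ i₀) (h₀ : q i₀ = 2) (h₁ : q i₁ = 2) :
    4 * ∏ i, (m i * (q i - 1)) ≤ ∏ i, (m i * q i) := by
  classical
  have hsplit : ∀ f : ι → ℝ, ∏ i, f i = f i₀ * (f i₁ * ∏ i ∈ (Finset.univ.erase i₀).erase i₁, f i) :=
    fun f => by
      rw [Finset.mul_prod_erase _ _ (Finset.mem_erase.2 ⟨hne, Finset.mem_univ i₁⟩),
        Finset.mul_prod_erase _ _ (Finset.mem_univ i₀)]
  rw [hsplit, hsplit, h₀, h₁]
  have h : ∏ i ∈ (Finset.univ.erase i₀).erase i₁, (m i * (q i - 1))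
      ≤ ∏ i ∈ (Finset.univ.erase i₀).erase i₁, (m i * q i) := by
    refine Finset.prod_le_prod (fun i _ => ?_) fun i _ => ?_
    · have := hm i
      have := hq i
      exact mul_nonneg (by linarith) (by linarith)
    · have := hm i
      nlinarith
  have : 0 ≤ m i₀ * m i₁ := mul_nonneg (by linarith [hm i₀]) (by linarith [hm i₁])
  nlinarith [mul_le_mul_of_nonneg_left h this]

theorem one_le_prod_mul_sub_one {m : ι → ℝ} (hm : ∀ i, 1 ≤ m i) (hq : ∀ i, 2 ≤ q i) :
    1 ≤ ∏ i, (m i * (q i - 1)) :=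
  Finset.one_le_prod fun i _ => by nlinarith [hm i, hq i]

theorem sub_one_le_prod_mul_sub_one {m : ι → ℝ} (hm : ∀ i, 1 ≤ m i) (hq : ∀ i, 2 ≤ q i) (i : ι) :
    q i - 1 ≤ ∏ i, (m i * (q i - 1)) := by
  classical
  rw [← Finset.mul_prod_erase _ _ (Finset.mem_univ i)]
  have h1 : 1 ≤ ∏ j ∈ Finset.univ.erase i, (m j * (q j - 1)) :=
    Finset.one_le_prod fun i _ => by nlinarith [hm i, hq i]
  have h2 : q i - 1 ≤ m i * (q i - 1) := by nlinarith [hm i, hq i]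
  nlinarith [hq i]

theorem prod_mul_sub_one_add_le_prod {m : ι → ℝ} (hm : ∀ i, 1 ≤ m i) (hq : ∀ i, 2 ≤ q i)
    {i₀ i₁ : ι} (hne : i₁ ≠ i₀) :
    ∏ i, (m i * (q i - 1)) + (∏ i, (m i * (q i - 1))) * (q i₀ - 1)⁻¹ + 2
      ≤ ∏ i, (m i * q i) := by
  classical
  rw [← Finset.mul_prod_erase _ _ (Finset.mem_univ i₀),
    ← Finset.mul_prod_erase _ (fun i => m i * q i) (Finset.mem_univ i₀)]
  have h := Finset.prod_add_one_le_prod (S := Finset.univ.erase i₀)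
    (f := fun i => m i * (q i - 1)) (g := fun i => m i * q i)
    ⟨i₁, Finset.mem_erase.2 ⟨hne, Finset.mem_univ _⟩⟩
    (fun i _ => mul_nonneg (by linarith [hm i]) (by linarith [hq i]))
    (fun i _ => by linarith [hm i])
  set P := ∏ i ∈ Finset.univ.erase i₀, (m i * (q i - 1))
  have h0 : q i₀ - 1 ≠ 0 := by linarith [hq i₀]
  have h1 : m i₀ * (q i₀ - 1) * P * (q i₀ - 1)⁻¹ = m i₀ * P := by field_simp
  have h2 : 2 ≤ m i₀ * q i₀ := by nlinarith [hm i₀, hq i₀]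
  rw [h1]
  nlinarith [mul_le_mul_of_nonneg_left h (by linarith : 0 ≤ m i₀ * q i₀)]

end Inequalities

/-! ### Solving the quadratic inequalities -/

theorem abs_le_two_mul_sqrt_iff {x t : ℝ} (ht : 0 ≤ t) : |x| ≤ 2 * √t ↔ x ^ 2 ≤ 4 * t := by
  rw [← abs_of_nonneg (by positivity : 0 ≤ 2 * √t), ← sq_le_sq, mul_pow, Real.sq_sqrt ht]
  norm_num

theorem sq_one_add_le_iff_of_two_pow {T M : ℝ} (hT : 4 ≤ T) (hM : 1 ≤ M) :
    (1 + M) ^ 2 ≤ 4 * (T * M - 1 - M - 1) ↔ M ≤ T * 2 - 3 + 2 * √(T * (T - 3)) := by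
  have h0 : 0 ≤ T * (T - 3) := mul_nonneg (by linarith) (by linarith)
  have hw : T - 2 ≤ √(T * (T - 3)) := Real.le_sqrt_of_sq_le (by nlinarith)
  have h1 : (1 + M) ^ 2 ≤ 4 * (T * M - 1 - M - 1) ↔ (M - (T * 2 - 3)) ^ 2 ≤ 4 * (T * (T - 3)) := by
    constructor <;> intro h <;> nlinarith
  rw [h1, ← abs_le_two_mul_sqrt_iff h0, abs_le]
  constructor
  · rintro ⟨_, h⟩
    linarith
  · intro h
    constructor <;> linarith

theorem sq_one_add_le_iff {n U : ℝ} (hn : 0 ≤ n) (hU : 0 ≤ U) :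
    (1 + U) ^ 2 ≤ 4 * (n - 1 - U - 1) ↔ U ≤ 2 * √n - 3 := by
  have h1 : (1 + U) ^ 2 ≤ 4 * (n - 1 - U - 1) ↔ (U + 3) ^ 2 ≤ 4 * n := by
    constructor <;> intro h <;> nlinarith
  rw [h1, ← abs_le_two_mul_sqrt_iff hn, abs_of_nonneg (by linarith), le_sub_iff_add_le]

theorem sq_sub_one_le_iff {n U q : ℝ} (hU : 0 ≤ U) (hq : 2 ≤ q) :
    (U / (q - 1) - 1) ^ 2 ≤ 4 * (n - 1 - U - 1) ↔
      U / (q - 1) ≤ -(2 * q - 3) + √((2 * q - 3) ^ 2 + (4 * n - 9)) := by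
  have hq' : 0 < q - 1 := by linarith
  obtain ⟨a, ha, rfl⟩ : ∃ a, 0 ≤ a ∧ U = (q - 1) * a :=
    ⟨U / (q - 1), by positivity, by field_simp⟩
  rw [mul_div_cancel_left₀ _ hq'.ne', ← sub_le_iff_le_add', sub_neg_eq_add,
    Real.le_sqrt' (by linarith)]
  constructor <;> intro h <;> nlinarith

theorem sq_sub_one_le_iff_of_two {n U : ℝ} (hn : 2 ≤ n) (hU : 0 ≤ U) :
    (U / (2 - 1) - 1) ^ 2 ≤ 4 * (n - 1 - U - 1) ↔ U ≤ 2 * √(n - 2) - 1 := by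
  have h1 : (U / (2 - 1) - 1) ^ 2 ≤ 4 * (n - 1 - U - 1) ↔ (U + 1) ^ 2 ≤ 4 * (n - 2) := by
    norm_num
    constructor <;> intro h <;> nlinarith
  rw [h1, ← abs_le_two_mul_sqrt_iff (by linarith), abs_of_nonneg (by linarith),
    le_sub_iff_add_le]

/-! ### The two cases of the criterion -/

section Criterion

variable {ι : Type*} [Fintype ι] {R : ι → Type*} [∀ i, CommRing (R i)] [∀ i, IsLocalRing (R i)]
  [∀ i, Fintype (R i)]

theorem two_le_residueRatio (A : Type*) [CommRing A] [IsLocalRing A] [Fintype A] :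
    2 ≤ residueRatio A := by
  rcases residueRatio_eq_two_or_three_le A with h | h <;> linarith

theorem one_le_maxIdealCard (A : Type*) [CommRing A] [IsLocalRing A] [Fintype A] :
    (1 : ℝ) ≤ maxIdealCard A := by
  exact_mod_cast maxIdealCard_pos (A := A)

theorem one_le_card_pi_units : (1 : ℝ) ≤ Nat.card (∀ i, R i)ˣ := by
  rw [card_pi_units]
  exact one_le_prod_mul_sub_one (fun i => one_le_maxIdealCard _) fun i => two_le_residueRatio _

variable [Fintype (∀ i, R i)]

/-- With two residue fields of order two, the decisive eigenvalue is `-1 - |Rˣ|`, coming from the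
character that is nontrivial on exactly these two residue fields. -/
theorem isRamanujan_compl_pi_iff_of_two_eq_two {i₀ i₁ : ι} (hne : i₁ ≠ i₀)
    (h₀ : residueRatio (R i₀) = 2) (h₁ : residueRatio (R i₁) = 2) :
    IsRamanujan (unitaryCayleyGraph (∀ i, R i))ᶜ ↔
      (1 + Nat.card (∀ i, R i)ˣ : ℝ) ^ 2
        ≤ 4 * ((Nat.card (∀ i, R i) : ℝ) - 1 - Nat.card (∀ i, R i)ˣ - 1) := by
  classical
  have : Nontrivial (∀ i, R i) := Pi.nontrivial_at i₀
  have hU := one_le_card_pi_units (R := R)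
  have hn := four_mul_prod_le_prod (fun i => one_le_maxIdealCard (R i))
    (fun i => two_le_residueRatio (R i)) hne h₀ h₁
  rw [← card_pi_units, ← card_pi_eq_prod] at hn
  rw [isRamanujan_compl_iff]
  set U : ℝ := (Nat.card (∀ i, R i)ˣ : ℝ)
  set n : ℝ := (Nat.card (∀ i, R i) : ℝ)
  constructor
  · intro h
    obtain ⟨ψ, hψ, hS⟩ := exists_unitSum_pi_eq_prod_inv (R := R) {i₀, i₁} ⟨i₀, by simp⟩
    rw [Finset.prod_pair hne.symm, h₀, h₁] at hS
    specialize h ψ hψ (-1 - U) (by rw [hS]; push_cast; norm_num [U])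
    rw [abs_le_two_mul_sqrt_iff (by linarith)] at h
    -- The eigenvalue equals the negative of the degree only for `|R| = 4` and `|Rˣ| = 1`, where
    -- the inequality holds.
    by_cases hr : -1 - U = -(n - 1 - U)
    · have : U = 1 := by linarith
      have : n = 4 := by linarith
      rw [this, ‹U = 1›]
      norm_num
    · have := h (by intro h; linarith) hr
      linarith
  · intro h ψ hψ μ hμ _ _
    obtain ⟨e, he, -, hS⟩ := exists_unitSum_pi_eq hψ
    have hμ' : μ = -1 - U * ∏ i, e i := by
      rw [hS] at hμ
      exact_mod_cast hμ
    have h1 := Finset.abs_prod_le_one (S := Finset.univ)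
      (abs_le_one_of_eq_neg_inv (fun i => two_le_residueRatio (R i)) he)
    rw [abs_le_two_mul_sqrt_iff (by linarith)]
    refine le_trans (sq_le_sq.2 ?_) h
    rw [abs_of_nonneg (by linarith : 0 ≤ 1 + U), hμ', abs_le]
    rw [abs_le] at h1
    constructor <;> nlinarith

/-- With at most one residue field of order two, the decisive eigenvalue is
`|Rˣ| / (q₀ - 1) - 1`, coming from the character that is nontrivial on exactly the smallest residue
field, of order `q₀`. -/
theorem isRamanujan_compl_pi_iff_of_three_le {i₀ i₁ : ι} (hne : i₁ ≠ i₀)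
    (hmin : ∀ i, residueRatio (R i₀) ≤ residueRatio (R i))
    (h₃ : ∀ i, i ≠ i₀ → 3 ≤ residueRatio (R i)) :
    IsRamanujan (unitaryCayleyGraph (∀ i, R i))ᶜ ↔
      ((Nat.card (∀ i, R i)ˣ : ℝ) / (residueRatio (R i₀) - 1) - 1) ^ 2
        ≤ 4 * ((Nat.card (∀ i, R i) : ℝ) - 1 - Nat.card (∀ i, R i)ˣ - 1) := by
  classical
  have : Nontrivial (∀ i, R i) := Pi.nontrivial_at i₀
  have hU := one_le_card_pi_units (R := R)
  have hn := prod_mul_sub_one_add_le_prod (fun i => one_le_maxIdealCard (R i))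
    (fun i => two_le_residueRatio (R i)) hne
  rw [← card_pi_units, ← card_pi_eq_prod] at hn
  rw [isRamanujan_compl_iff]
  set U : ℝ := (Nat.card (∀ i, R i)ˣ : ℝ)
  set n : ℝ := (Nat.card (∀ i, R i) : ℝ)
  have hq := two_le_residueRatio (R i₀)
  rw [div_eq_mul_inv]
  have ha : 1 ≤ U * (residueRatio (R i₀) - 1)⁻¹ := by
    rw [← div_eq_mul_inv, one_le_div (by linarith)]
    have := sub_one_le_prod_mul_sub_one (fun i => one_le_maxIdealCard (R i))
      (fun i => two_le_residueRatio (R i)) i₀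
    rwa [← card_pi_units] at this
  constructor
  · intro h
    obtain ⟨ψ, hψ, hS⟩ := exists_unitSum_pi_eq_prod_inv (R := R) {i₀} ⟨i₀, by simp⟩
    rw [Finset.prod_singleton] at hS
    specialize h ψ hψ (U * (residueRatio (R i₀) - 1)⁻¹ - 1)
      (by rw [hS]; push_cast; simp only [U]; push_cast; ring)
    rw [abs_le_two_mul_sqrt_iff (by linarith)] at h
    exact h (by intro h; linarith) (by intro h; linarith)
  · intro h ψ hψ μ hμ _ _
    obtain ⟨e, he, hex, hS⟩ := exists_unitSum_pi_eq hψ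
    have hμ' : μ = -1 - U * ∏ i, e i := by
      rw [hS] at hμ
      exact_mod_cast hμ
    rw [abs_le_two_mul_sqrt_iff (by linarith), hμ']
    set b := (residueRatio (R i₀) - 1)⁻¹
    set E := ∏ i, e i
    -- In the first case the eigenvalue lies in `[-1, a - 1]`, in the second its absolute value is
    -- at most `1 + a / 2`; this is at most `a - 1` if `4 ≤ a`, and for smaller `a` the degree is
    -- large enough.
    have h4 : (1 + U * b / 2) ^ 2 ≤ 4 * (n - 1 - U - 1) := by
      rcases le_total 4 (U * b) with h5 | h5
      · exact le_trans (pow_le_pow_left₀ (by linarith) (by linarith) 2) h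
      · nlinarith [mul_nonneg (sub_nonneg.2 ha) (sub_nonneg.2 h5)]
    rcases prod_mem_Icc_or_abs_prod_le
        (q := fun i => residueRatio (R i)) hq hmin h₃ he hex with ⟨hl, hu⟩ | hh
    · have hl' : U * E ≤ 0 := by nlinarith
      have hu' : -(U * b) ≤ U * E := by nlinarith
      rcases le_total 2 (U * b) with h5 | h5
      · exact le_trans (sq_le_sq' (by linarith) (by linarith)) h
      · exact le_trans (sq_le_sq' (by linarith) (by linarith)) h4
    · refine le_trans (sq_le_sq.2 ?_) h4
      rw [abs_of_nonneg (by linarith : 0 ≤ 1 + U * b / 2), abs_le]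
      rw [abs_le] at hh
      constructor <;> nlinarith

end Criterion

/-! ### The classification -/

theorem theorem4p2 (s : ℕ) (hs : 2 ≤ s) (R : Fin s → Type*)
    [∀ i, CommRing (R i)] [∀ i, IsLocalRing (R i)] [∀ i, Fintype (R i)]
    (hR : ∀ i j : Fin s, i ≤ j → residueRatio (R i) ≤ residueRatio (R j)) :
    IsRamanujan (unitaryCayleyGraph (∀ i, R i))ᶜ ↔
      -- (a)
      ((∀ i, residueRatio (R i) = 2) ∧
        ((∏ i, maxIdealCard (R i) : ℕ) : ℝ)
          ≤ 2 ^ (s + 1) - 3 + 2 * √((2 : ℝ) ^ s * ((2 : ℝ) ^ s - 3))) ∨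
      -- (b): the factors are indexed from 0, so index `t` is the factor number `t + 1`
      ((∃ (t : ℕ) (ht : t < s), 2 ≤ t ∧ (∀ i : Fin s, (i : ℕ) < t → residueRatio (R i) = 2) ∧
          2 < residueRatio (R ⟨t, ht⟩)) ∧
        (Nat.card (∀ i, R i)ˣ : ℝ) ≤ 2 * √(Nat.card (∀ i, R i) : ℝ) - 3) ∨
      -- (c)
      ((residueRatio (R ⟨0, by omega⟩) = 2 ∧ 2 < residueRatio (R ⟨1, by omega⟩)) ∧
        (Nat.card (∀ i, R i)ˣ : ℝ) ≤ 2 * √((Nat.card (∀ i, R i) : ℝ) - 2) - 1) ∨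
      -- (d)
      (3 ≤ residueRatio (R ⟨0, by omega⟩) ∧
        (Nat.card (∀ i, R i)ˣ : ℝ) / (residueRatio (R ⟨0, by omega⟩) - 1)
          ≤ -(2 * residueRatio (R ⟨0, by omega⟩) - 3)
            + √((2 * residueRatio (R ⟨0, by omega⟩) - 3) ^ 2
                + (4 * (Nat.card (∀ i, R i) : ℝ) - 9))) := by
  have hs₀ : 0 < s := by omega
  have hs₁ : 1 < s := by omega
  have h10 : (⟨1, hs₁⟩ : Fin s) ≠ ⟨0, hs₀⟩ := by simp
  have hU := one_le_card_pi_units (R := R)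
  have htwo : ∀ i, 2 ≤ residueRatio (R i) := fun i => two_le_residueRatio (R i)
  have hthree : ∀ i, 2 < residueRatio (R i) → 3 ≤ residueRatio (R i) := fun i hi =>
    (residueRatio_eq_two_or_three_le (R i)).resolve_left hi.ne'
  have hmin : ∀ i, residueRatio (R ⟨0, hs₀⟩) ≤ residueRatio (R i) := fun i =>
    hR _ _ (Fin.mk_le_of_le_val (Nat.zero_le _))
  have hmin₁ : ∀ i, i ≠ ⟨0, hs₀⟩ → residueRatio (R ⟨1, hs₁⟩) ≤ residueRatio (R i) := by
    intro i hi
    refine hR _ _ (Fin.mk_le_of_le_val ?_)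
    have : (i : ℕ) ≠ 0 := fun h => hi (Fin.ext h)
    omega
  have hn : (2 : ℝ) ≤ Nat.card (∀ i, R i) := by
    have h := prod_mul_sub_one_add_le_prod (fun i => one_le_maxIdealCard (R i)) htwo h10
    have h' := sub_one_le_prod_mul_sub_one (fun i => one_le_maxIdealCard (R i)) htwo ⟨0, hs₀⟩
    rw [← card_pi_units] at h h'
    rw [← card_pi_eq_prod] at h
    have : 0 ≤ (Nat.card (∀ i, R i)ˣ : ℝ) * (residueRatio (R ⟨0, hs₀⟩) - 1)⁻¹ :=
      mul_nonneg (by linarith) (inv_nonneg.2 (by linarith [htwo ⟨0, hs₀⟩]))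
    linarith
  -- the criterion in each of the four configurations of residue fields
  have ha : (∀ i, residueRatio (R i) = 2) → (IsRamanujan (unitaryCayleyGraph (∀ i, R i))ᶜ ↔
      ((∏ i, maxIdealCard (R i) : ℕ) : ℝ)
        ≤ 2 ^ (s + 1) - 3 + 2 * √((2 : ℝ) ^ s * ((2 : ℝ) ^ s - 3))) := by
    intro h
    have hM : (Nat.card (∀ i, R i)ˣ : ℝ) = ((∏ i, maxIdealCard (R i) : ℕ) : ℝ) := by
      rw [card_pi_units]
      push_cast
      exact Finset.prod_congr rfl fun i _ => by rw [h i]; ring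
    have hN : (Nat.card (∀ i, R i) : ℝ) = 2 ^ s * ((∏ i, maxIdealCard (R i) : ℕ) : ℝ) := by
      rw [card_pi_eq_prod]
      simp only [h, Finset.prod_mul_distrib]
      push_cast
      simp [mul_comm]
    have hT : (4 : ℝ) ≤ 2 ^ s := by
      calc (4 : ℝ) = 2 ^ 2 := by norm_num
        _ ≤ 2 ^ s := pow_le_pow_right₀ (by norm_num) hs
    rw [isRamanujan_compl_pi_iff_of_two_eq_two h10 (h _) (h _), hN, hM, pow_succ]
    exact sq_one_add_le_iff_of_two_pow hT (hM ▸ hU)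
  have hb : residueRatio (R ⟨0, hs₀⟩) = 2 → residueRatio (R ⟨1, hs₁⟩) = 2 →
      (IsRamanujan (unitaryCayleyGraph (∀ i, R i))ᶜ ↔
        (Nat.card (∀ i, R i)ˣ : ℝ) ≤ 2 * √(Nat.card (∀ i, R i) : ℝ) - 3) := fun h₀ h₁ => by
    rw [isRamanujan_compl_pi_iff_of_two_eq_two h10 h₀ h₁]
    exact sq_one_add_le_iff (by linarith) (by linarith)
  have hc : residueRatio (R ⟨0, hs₀⟩) = 2 → 2 < residueRatio (R ⟨1, hs₁⟩) →
      (IsRamanujan (unitaryCayleyGraph (∀ i, R i))ᶜ ↔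
        (Nat.card (∀ i, R i)ˣ : ℝ) ≤ 2 * √((Nat.card (∀ i, R i) : ℝ) - 2) - 1) := fun h₀ h₁ => by
    rw [isRamanujan_compl_pi_iff_of_three_le h10 hmin
      (fun i hi => (hthree _ h₁).trans (hmin₁ i hi)), h₀]
    exact sq_sub_one_le_iff_of_two hn (by linarith)
  have hd : 3 ≤ residueRatio (R ⟨0, hs₀⟩) → (IsRamanujan (unitaryCayleyGraph (∀ i, R i))ᶜ ↔
      (Nat.card (∀ i, R i)ˣ : ℝ) / (residueRatio (R ⟨0, hs₀⟩) - 1)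
        ≤ -(2 * residueRatio (R ⟨0, hs₀⟩) - 3)
          + √((2 * residueRatio (R ⟨0, hs₀⟩) - 3) ^ 2
              + (4 * (Nat.card (∀ i, R i) : ℝ) - 9))) := fun h₀ => by
    rw [isRamanujan_compl_pi_iff_of_three_le h10 hmin (fun i _ => h₀.trans (hmin i))]
    exact sq_sub_one_le_iff (by linarith) (htwo _)
  constructor
  · intro h
    rcases residueRatio_eq_two_or_three_le (R ⟨0, hs₀⟩) with h₀ | h₀
    · by_cases hall : ∀ i, residueRatio (R i) = 2
      · exact Or.inl ⟨hall, (ha hall).1 h⟩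
      · rcases (htwo ⟨1, hs₁⟩).eq_or_lt' with h₁ | h₁
        · classical
          -- `t` is the first index whose residue field has more than two elements
          have hex : ∃ t, ∃ ht : t < s, residueRatio (R ⟨t, ht⟩) ≠ 2 := by
            push Not at hall
            obtain ⟨i, hi⟩ := hall
            exact ⟨i, i.2, hi⟩
          obtain ⟨ht, ht'⟩ := Nat.find_spec hex
          refine Or.inr (Or.inl ⟨⟨Nat.find hex, ht, ?_, ?_, (htwo _).lt_of_ne' ht'⟩,
            (hb h₀ h₁).1 h⟩)
          · rw [Nat.two_le_iff]
            constructor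
            · intro h0
              have hi : (⟨Nat.find hex, ht⟩ : Fin s) = ⟨0, hs₀⟩ := Fin.ext h0
              exact ht' (hi ▸ h₀)
            · intro h1
              have hi : (⟨Nat.find hex, ht⟩ : Fin s) = ⟨1, hs₁⟩ := Fin.ext h1
              exact ht' (hi ▸ h₁)
          · intro i hi
            by_contra hne
            exact Nat.find_min hex hi ⟨i.2, hne⟩
        · exact Or.inr (Or.inr (Or.inl ⟨⟨h₀, h₁⟩, (hc h₀ h₁).1 h⟩))
    · exact Or.inr (Or.inr (Or.inr ⟨h₀, (hd h₀).1 h⟩))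
  · rintro (⟨hall, h⟩ | ⟨⟨t, ht, ht2, htt, -⟩, h⟩ | ⟨⟨h₀, h₁⟩, h⟩ | ⟨h₀, h⟩)
    · exact (ha hall).2 h
    · exact (hb (htt _ (by simp; omega)) (htt _ (by simp; omega))).2 h
    · exact (hc h₀ h₁).2 h
    · exact (hd h₀).2 h
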